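/- For $d\ge 1$ let $\mathbb H^d=\{(z,x): z>0,\ x\in\mathbb R^{d-1}\}$ be hyperbolic space (half-space model) with the distance $$d_{\mathbb H}\big((z_1,x_1),(z_2,x_2)\big)=\operatorname{arccosh}\Big(1+\frac{\|x_1-x_2\|^2+(z_1-z_2)^2}{2z_1z_2}\Big).$$ A hash family on $\mathbb H^d$ is a random function $h$ from $\mathbb H^d$ to a countable set. For $r>0$, $c>1$ and $0<p_2<p_1<1$, it is $(r,cr,p_1,p_2)$-sensitive if, for all $x,y\in\mathbb H^d$, $d_{\mathbb H}(x,y)\le r$ implies $\Pr[h(x)=h(y)]\ge p_1$, and $d_{\mathbb H}(x,y)\ge cr$ implies $\Pr[h(x)=h(y)]\le p_2$; its exponent is $\rho=\log(1/p_1)/\log(1/p_2)$. Theorem. Let $c>1$. For every $d\ge 1$ there is $\tau=\tau(c,d)\in(0,1)$ such that every $(\tau d,c\tau d,p_1,p_2)$-sensitive hash family on $\mathbb H^d$ with $0<p_2<p_1<1$ satisfies $$\rho\ \ge\ \frac1{c^2}-o_d(1).$$ Here $o_d(1)$ tends to $0$ as $d\to\infty$ with $c$ fixed and $p_2$ bounded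 away from $0$: for every $\delta\in(0,1)$ there is a sequence $\varepsilon_d=\varepsilon_d(c,\delta)\to 0$ such that, for all $d\ge1$, all $\delta\le p_2<p_1<1$ and all such families, $\rho\ge 1/c^2-\varepsilon_d$. -/

import Mathlib

open Filter Topology MeasureTheory

universe u v w

/-- The half-space model of the hyperbolic space of dimension `d ≥ 1`: points `(z, x)` with
`z > 0` and `x` in the Euclidean space of dimension `d - 1`. -/
structure HyperbolicSpace (d : ℕ) where
  /-- the height `z` -/
  height : ℝ
  height_pos : 0 < height
  /-- the horizontal coordinate `x` -/
  base : EuclideanSpace ℝ (Fin (d - 1))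

/-- The hyperbolic distance (curvature `-1`) in the half-space model. -/
noncomputable instance HyperbolicSpace.instDist (d : ℕ) : Dist (HyperbolicSpace d) where
  dist p q := Real.arcosh
    (1 + (‖p.base - q.base‖ ^ 2 + (p.height - q.height) ^ 2) / (2 * p.height * q.height))

/-- A hash family on `X`: a random function `hash ω : X → U` into a countable set `U`, where `ω`
is drawn from a probability space, such that all collision events are measurable. A finite family
with the uniform choice of a member is a special case. -/
structure HashFamily (X : Type w) where
  /-- the sample space, which indexes the hash functions -/
  Ω : Type u
  [measurableSpace : MeasurableSpace Ω]
  /-- the law according to which the hash function is drawn -/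
  μ : Measure Ω
  [isProbabilityMeasure : IsProbabilityMeasure μ]
  /-- the set of hash values -/
  U : Type v
  [countable : Countable U]
  /-- the hash functions -/
  hash : Ω → X → U
  measurableSet_collision : ∀ x y : X, MeasurableSet {ω | hash ω x = hash ω y}

namespace HashFamily

attribute [instance] HashFamily.measurableSpace HashFamily.isProbabilityMeasure
  HashFamily.countable

/-- The probability that `x` and `y` receive the same hash value. -/
noncomputable def collisionProb {X : Type w} (H : HashFamily.{u, v, w} X) (x y : X) : ℝ :=
  H.μ.real {ω | H.hash ω x = H.hash ω y}

/-- `H` is `(r, c * r, p₁, p₂)`-sensitive. -/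
structure IsSensitive {X : Type w} [Dist X] (H : HashFamily.{u, v, w} X) (r c p₁ p₂ : ℝ) :
    Prop where
  r_pos : 0 < r
  one_lt_c : 1 < c
  p₂_pos : 0 < p₂
  p₂_lt_p₁ : p₂ < p₁
  p₁_lt_one : p₁ < 1
  near : ∀ x y : X, dist x y ≤ r → p₁ ≤ H.collisionProb x y
  far : ∀ x y : X, c * r ≤ dist x y → H.collisionProb x y ≤ p₂

end HashFamily

/-- The performance exponent `ρ = log (1 / p₁) / log (1 / p₂)` of an
`(r, c * r, p₁, p₂)`-sensitive family. -/
noncomputable def lshExponent (p₁ p₂ : ℝ) : ℝ :=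
  Real.log (1 / p₁) / Real.log (1 / p₂)

/-!
Let `n = d - 1`. The cube `{±1}ⁿ`, scaled to a suitable side length, lies in the horosphere `z = 1`
of `ℍᵈ`. There the hyperbolic distance is a function of the Euclidean one, and the square of the
latter is proportional to the Hamming distance. For `τ d = 1 / (d + 2) ^ 2` the radius `r = τ d * d`
tends to `0`, so that the hyperbolic radii `r` and `c r` correspond to Hamming distances with
ratio tending to `c ^ 2` (`eventually_cosh_mul_le`).

For a hash family let `K ρ` be the average collision probability of two uniformly random points of
the cube with correlation `ρ` in each coordinate. The collision probability is a positive
semidefinite kernel, so `K ρ = ∑ S, w S * ρ ^ #S` with `w S ≥ 0` and `∑ S, w S = 1`, and Jensen's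
inequality gives `K ρ ^ α ≤ K (ρ ^ α)` for `α ≥ 1` (`noiseAverage_rpow_le`). The distance of
`ρ`-correlated points is concentrated about `n (1 - ρ) / 2`
(`noiseAverage_le_of_concentrated`). If `α > c ^ 2` and `ρ < 1` is close to `1`, the ratio of the
mean distances of `ρ ^ α`-correlated and `ρ`-correlated points exceeds `c ^ 2`
(`exists_noise_rate`). Choosing the scale between them gives `K ρ ≥ p₁` and `K (ρ ^ α) ≤ p₂` up
to errors of order `1 / n` (`collision_rpow_le`), hence `log (1 / p₁) / log (1 / p₂) ≥ 1 / α` up to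
an error that vanishes as `d → ∞`. Finally `α` decreases to `c ^ 2`.

Since `p₂` may approach `1`, the errors have to be relative to `1 - p₁` and `1 - p₂`. For the first,
the rare pairs at distance more than `r` are not discarded: they are joined by a chain of
boundedly many steps of length at most `r`, so that they are separated with probability `O(1 - p₁)`
(`HashFamily.one_sub_collisionProb_le_mul`). Such relative errors change `log p₁` and `log p₂` by
factors close to `1`, because `p₁` and `p₂` are at least `δ` (`lshExponent_ge_of_rpow_le`).
-/

/-! ### Noise on the discrete cube -/

/-- The coordinate `±1` encoded by a Boolean. -/
def boolSign (b : Bool) : ℝ := if b then 1 else -1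

lemma boolSign_mul_self (b : Bool) : boolSign b * boolSign b = 1 := by
  cases b <;> simp [boolSign]

/-- The probability that two uniformly random points of the cube with correlation `ρ` in each
coordinate are `x` and `y`. -/
noncomputable def noiseWeight {ι : Type*} [Fintype ι] (ρ : ℝ) (x y : ι → Bool) : ℝ :=
  ∏ i, (1 + ρ * (boolSign (x i) * boolSign (y i))) / 4

/-- The expectation of `F x y` over a pair `(x, y)` of `ρ`-correlated points of the cube. -/
noncomputable def noiseAverage {ι : Type*} [Fintype ι] [DecidableEq ι] (ρ : ℝ)
    (F : (ι → Bool) → (ι → Bool) → ℝ) : ℝ :=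
  ∑ x, ∑ y, noiseWeight ρ x y * F x y

/-- The Hamming distance of two points of the cube, written as a polynomial in their signs. -/
noncomputable def signDist {ι : Type*} [Fintype ι] (x y : ι → Bool) : ℝ :=
  ∑ i, (1 - boolSign (x i) * boolSign (y i)) / 2

section Cube

variable {ι : Type*} [Fintype ι]

lemma noiseWeight_nonneg {ρ : ℝ} (h0 : 0 ≤ ρ) (h1 : ρ ≤ 1) (x y : ι → Bool) :
    0 ≤ noiseWeight ρ x y := by
  refine Finset.prod_nonneg fun i _ => ?_
  cases x i <;> cases y i <;> simp [boolSign] <;> linarith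

lemma signDist_nonneg (x y : ι → Bool) : 0 ≤ signDist x y := by
  refine Finset.sum_nonneg fun i _ => ?_
  cases x i <;> cases y i <;> norm_num [boolSign]

lemma signDist_le_card (x y : ι → Bool) : signDist x y ≤ Fintype.card ι := by
  have : signDist x y ≤ ∑ _i : ι, (1 : ℝ) := by
    refine Finset.sum_le_sum fun i _ => ?_
    cases x i <;> cases y i <;> norm_num [boolSign]
  simpa using this

variable [DecidableEq ι]

lemma noiseAverage_mono {ρ : ℝ} (h0 : 0 ≤ ρ) (h1 : ρ ≤ 1) {F G : (ι → Bool) → (ι → Bool) → ℝ}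
    (h : ∀ x y, F x y ≤ G x y) : noiseAverage ρ F ≤ noiseAverage ρ G :=
  Finset.sum_le_sum fun x _ => Finset.sum_le_sum fun y _ =>
    mul_le_mul_of_nonneg_left (h x y) (noiseWeight_nonneg h0 h1 x y)

lemma noiseAverage_add (ρ : ℝ) (F G : (ι → Bool) → (ι → Bool) → ℝ) :
    noiseAverage ρ (fun x y => F x y + G x y) = noiseAverage ρ F + noiseAverage ρ G := by
  simp [noiseAverage, mul_add, Finset.sum_add_distrib]

lemma noiseAverage_const_mul (ρ a : ℝ) (F : (ι → Bool) → (ι → Bool) → ℝ) :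
    noiseAverage ρ (fun x y => a * F x y) = a * noiseAverage ρ F := by
  simp [noiseAverage, mul_left_comm _ a, Finset.mul_sum]

lemma sum_sum_prod_apply (F : ι → Bool → Bool → ℝ) :
    ∑ x : ι → Bool, ∑ y : ι → Bool, ∏ i, F i (x i) (y i) = ∏ i, ∑ a, ∑ b, F i a b := by
  have h (x : ι → Bool) : ∑ y : ι → Bool, ∏ i, F i (x i) (y i) = ∏ i, ∑ b, F i (x i) b := by
    rw [Finset.prod_univ_sum, Fintype.piFinset_univ]
  simp_rw [h]
  rw [Finset.prod_univ_sum, Fintype.piFinset_univ]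

lemma noiseAverage_prod (ρ : ℝ) (F : ι → Bool → Bool → ℝ) :
    noiseAverage ρ (fun x y => ∏ i, F i (x i) (y i)) =
      ∏ i, ∑ a, ∑ b, (1 + ρ * (boolSign a * boolSign b)) / 4 * F i a b := by
  rw [← sum_sum_prod_apply]
  simp [noiseAverage, noiseWeight, Finset.prod_mul_distrib]

lemma noiseAverage_one (ρ : ℝ) : noiseAverage (ι := ι) ρ (fun _ _ => 1) = 1 := by
  have := noiseAverage_prod (ι := ι) ρ (fun _ _ _ => 1)
  simp only [Finset.prod_const_one] at this
  rw [this]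
  refine Finset.prod_eq_one fun i _ => ?_
  simp [boolSign]; ring

lemma noiseAverage_affine (ρ a b : ℝ) (F : (ι → Bool) → (ι → Bool) → ℝ) :
    noiseAverage ρ (fun x y => a + b * F x y) = a + b * noiseAverage ρ F := by
  have h := noiseAverage_const_mul (ι := ι) ρ a (fun _ _ => 1)
  rw [noiseAverage_one] at h
  rw [noiseAverage_add, noiseAverage_const_mul]
  simp only [mul_one] at h
  rw [h]

lemma noiseAverage_sum {κ : Type*} (s : Finset κ) (ρ : ℝ)
    (F : κ → (ι → Bool) → (ι → Bool) → ℝ) :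
    noiseAverage ρ (fun x y => ∑ k ∈ s, F k x y) = ∑ k ∈ s, noiseAverage ρ (F k) := by
  simp only [noiseAverage, Finset.mul_sum]
  rw [Finset.sum_congr rfl fun x _ => Finset.sum_comm, Finset.sum_comm]

/-- The coordinates of a pair of `ρ`-correlated points are independent, so that the variances of
the coordinatewise distances add up. -/
lemma noiseAverage_sq_signDist_sub (ρ : ℝ) :
    noiseAverage (ι := ι) ρ (fun x y => (signDist x y - Fintype.card ι * ((1 - ρ) / 2)) ^ 2) =
      Fintype.card ι * ((1 - ρ ^ 2) / 4) := by
  let g : Bool → Bool → ℝ := fun a b => (ρ - boolSign a * boolSign b) / 2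
  have hg (x y : ι → Bool) : (signDist x y - Fintype.card ι * ((1 - ρ) / 2)) ^ 2 =
      ∑ j, ∑ k, ∏ i, (if i = j then g (x i) (y i) else 1) * if i = k then g (x i) (y i) else 1 := by
    have : signDist x y - Fintype.card ι * ((1 - ρ) / 2) = ∑ i, g (x i) (y i) := by
      have h : (Fintype.card ι : ℝ) * ((1 - ρ) / 2) = ∑ _i : ι, (1 - ρ) / 2 := by simp
      rw [signDist, h, ← Finset.sum_sub_distrib]
      exact Finset.sum_congr rfl fun i _ => by simp only [g]; ring
    rw [this, sq, Finset.sum_mul_sum]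
    refine Finset.sum_congr rfl fun j _ => Finset.sum_congr rfl fun k _ => ?_
    rw [Finset.prod_mul_distrib]
    simp
  simp_rw [hg, noiseAverage_sum]
  have hjk (j k : ι) : noiseAverage ρ (fun x y : ι → Bool =>
      ∏ i, (if i = j then g (x i) (y i) else 1) * if i = k then g (x i) (y i) else 1) =
      if j = k then (1 - ρ ^ 2) / 4 else 0 := by
    rw [noiseAverage_prod ρ (fun i a b => (if i = j then g a b else 1) * if i = k then g a b else 1)]
    split_ifs with h
    · subst h
      rw [Finset.prod_eq_single j]
      · simp [g, boolSign]; ring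
      · intro i _ hi
        simp [hi, boolSign]; ring
      · simp
    · refine Finset.prod_eq_zero (Finset.mem_univ j) ?_
      simp [h, g, boolSign]; ring
  simp_rw [hjk]
  simp

/-- A positive semidefinite kernel on the cube with diagonal `1` has nonnegative Fourier weights
`w S` with sum `1`, and its average over `ρ`-correlated pairs is `∑ S, w S * ρ ^ #S`. Hence Jensen's
inequality applies to it. -/
lemma noiseAverage_rpow_le {P : (ι → Bool) → (ι → Bool) → ℝ}
    (hP : ∀ g : (ι → Bool) → ℝ, 0 ≤ ∑ x, ∑ y, P x y * (g x * g y)) (hdiag : ∀ x, P x x = 1)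
    {ρ α : ℝ} (hρ : 0 ≤ ρ) (hα : 1 ≤ α) :
    noiseAverage ρ P ^ α ≤ noiseAverage (ρ ^ α) P := by
  let χ : Finset ι → (ι → Bool) → ℝ := fun S x => ∏ i ∈ S, boolSign (x i)
  let N : ℝ := (4 ^ Fintype.card ι)⁻¹
  let w : Finset ι → ℝ := fun S => N * ∑ x, ∑ y, P x y * (χ S x * χ S y)
  have hexp (s : ℝ) (x y : ι → Bool) :
      noiseWeight s x y = ∑ S, N * s ^ S.card * (χ S x * χ S y) := by
    rw [noiseWeight, Finset.prod_div_distrib, Finset.prod_one_add, Finset.powerset_univ,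
      Finset.sum_div]
    refine Finset.sum_congr rfl fun S _ => ?_
    simp [χ, N, Finset.prod_mul_distrib]
    ring
  have hK (s : ℝ) : noiseAverage s P = ∑ S, w S * s ^ S.card := by
    have h1 (x y : ι → Bool) : noiseWeight s x y * P x y =
        ∑ S, N * s ^ S.card * (P x y * (χ S x * χ S y)) := by
      rw [hexp, Finset.sum_mul]
      exact Finset.sum_congr rfl fun S _ => by ring
    simp only [noiseAverage, h1, w]
    rw [Finset.sum_congr rfl fun x _ => Finset.sum_comm, Finset.sum_comm]
    refine Finset.sum_congr rfl fun S _ => ?_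
    simp only [← Finset.mul_sum]
    ring
  have hw : ∀ S ∈ Finset.univ, 0 ≤ w S := fun S _ =>
    mul_nonneg (by simp only [N]; positivity) (hP (χ S))
  -- For correlation `1` the two points coincide.
  have hw1 : ∑ S, w S = 1 := by
    have h1 : noiseAverage 1 P = noiseAverage (ι := ι) 1 (fun _ _ => 1) := by
      refine Finset.sum_congr rfl fun x _ => Finset.sum_congr rfl fun y _ => ?_
      by_cases hxy : x = y
      · rw [hxy, hdiag]
      · obtain ⟨i, hi⟩ := Function.ne_iff.mp hxy
        have : noiseWeight 1 x y = 0 := by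
          refine Finset.prod_eq_zero (Finset.mem_univ i) ?_
          revert hi
          cases x i <;> cases y i <;> simp [boolSign]
        simp [this]
    have h2 := hK 1
    rw [h1, noiseAverage_one] at h2
    simpa using h2.symm
  rw [hK, hK]
  refine (Real.rpow_arith_mean_le_arith_mean_rpow Finset.univ w (fun S => ρ ^ S.card) hw hw1
    (fun S _ => by positivity) hα).trans_eq ?_
  refine Finset.sum_congr rfl fun S _ => ?_
  rw [← Real.rpow_natCast_mul hρ, ← Real.rpow_mul_natCast hρ, mul_comm α]

/-- Chebyshev's inequality: if `F ≤ A + B` everywhere, and `F ≤ A` on the pairs whose distance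
deviates from its mean by less than `t` per coordinate, then the average of `F` exceeds `A` by
`O(1 / #ι)` only. -/
lemma noiseAverage_le_of_concentrated {ρ t A B : ℝ} (h0 : 0 ≤ ρ) (h1 : ρ ≤ 1) (hB : 0 ≤ B)
    (ht : 0 < t) (hι : 0 < Fintype.card ι) {F : (ι → Bool) → (ι → Bool) → ℝ}
    (hF : ∀ x y, |signDist x y - Fintype.card ι * ((1 - ρ) / 2)| < Fintype.card ι * t → F x y ≤ A)
    (hall : ∀ x y, F x y ≤ A + B) :
    noiseAverage ρ F ≤ A + B * (1 / (t ^ 2 * Fintype.card ι)) := by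
  have hn : (0 : ℝ) < Fintype.card ι := by exact_mod_cast hι
  set n : ℝ := (Fintype.card ι : ℝ) with hn_def
  have hpt (x y : ι → Bool) :
      F x y ≤ A + B / (n * t) ^ 2 * (signDist x y - n * ((1 - ρ) / 2)) ^ 2 := by
    rcases lt_or_ge |signDist x y - n * ((1 - ρ) / 2)| (n * t) with h | h
    · have := hF x y h
      have : 0 ≤ B / (n * t) ^ 2 * (signDist x y - n * ((1 - ρ) / 2)) ^ 2 := by positivity
      linarith
    · have h2 : (n * t) ^ 2 ≤ (signDist x y - n * ((1 - ρ) / 2)) ^ 2 := by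
        rw [← sq_abs (signDist x y - _)]
        exact pow_le_pow_left₀ (by positivity) h 2
      have h3 : B ≤ B / (n * t) ^ 2 * (signDist x y - n * ((1 - ρ) / 2)) ^ 2 := by
        calc B = B / (n * t) ^ 2 * (n * t) ^ 2 := by field_simp
          _ ≤ _ := by gcongr
      linarith [hall x y]
  refine (noiseAverage_mono h0 h1 hpt).trans ?_
  rw [noiseAverage_affine, noiseAverage_sq_signDist_sub, ← hn_def]
  have : n * ((1 - ρ ^ 2) / 4) ≤ n := by nlinarith [sq_nonneg ρ]
  calc A + B / (n * t) ^ 2 * (n * ((1 - ρ ^ 2) / 4)) ≤ A + B / (n * t) ^ 2 * n := by gcongr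
    _ = _ := by field_simp

end Cube

/-! ### Collision probabilities -/

namespace HashFamily

variable {X : Type w} (H : HashFamily.{u, v, w} X)

lemma collisionProb_self (x : X) : H.collisionProb x x = 1 := by
  simp [collisionProb]

lemma collisionProb_le_one (x y : X) : H.collisionProb x y ≤ 1 := measureReal_le_one

/-- The probability that two points are separated obeys the triangle inequality. -/
lemma one_sub_collisionProb_triangle (x y z : X) :
    1 - H.collisionProb x z ≤ (1 - H.collisionProb x y) + (1 - H.collisionProb y z) := by
  have h (x y : X) : 1 - H.collisionProb x y = H.μ.real {ω | H.hash ω x = H.hash ω y}ᶜ := by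
    rw [collisionProb, probReal_compl_eq_one_sub (H.measurableSet_collision x y)]
  rw [h, h, h]
  refine (measureReal_mono ?_).trans (measureReal_union_le _ _)
  intro ω hω
  by_contra hc
  simp only [Set.mem_union, Set.mem_compl_iff, Set.mem_ofPred_eq, not_or, not_not] at hc hω
  exact hω (hc.1.trans hc.2)

/-- For a single hash function the kernel is `∑ a, 1[h x = a] * 1[h y = a]`, which is positive
semidefinite. -/
lemma sum_collision_nonneg {κ : Type*} [Fintype κ] {U : Type*} [DecidableEq U] (h : κ → U)
    (g : κ → ℝ) : 0 ≤ ∑ x, ∑ y, (if h x = h y then 1 else 0) * (g x * g y) := by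
  have hxy (x y : κ) : (if h x = h y then 1 else 0) * (g x * g y) =
      ∑ a ∈ Finset.univ.image h, (if h x = a then g x else 0) * (if h y = a then g y else 0) := by
    rw [Finset.sum_eq_single (h x)]
    · simp [eq_comm]
    · intro a _ ha
      simp [ha.symm]
    · intro hx
      simp at hx
  simp_rw [hxy]
  rw [Finset.sum_congr rfl fun x _ => Finset.sum_comm, Finset.sum_comm]
  refine Finset.sum_nonneg fun a _ => ?_
  rw [← Finset.sum_mul_sum]
  exact mul_self_nonneg _

lemma sum_collisionProb_nonneg {κ : Type*} [Fintype κ] (φ : κ → X) (g : κ → ℝ) :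
    0 ≤ ∑ x, ∑ y, H.collisionProb (φ x) (φ y) * (g x * g y) := by
  classical
  have hint (x y : κ) : Integrable (fun ω => (if H.hash ω (φ x) = H.hash ω (φ y) then (1 : ℝ)
      else 0) * (g x * g y)) H.μ :=
    ((integrable_const (1 : ℝ)).indicator
      (H.measurableSet_collision (φ x) (φ y))).mul_const _
  have hxy (x y : κ) : H.collisionProb (φ x) (φ y) * (g x * g y) =
      ∫ ω, (if H.hash ω (φ x) = H.hash ω (φ y) then 1 else 0) * (g x * g y) ∂H.μ := by
    rw [integral_mul_const, collisionProb,
      ← integral_indicator_one (H.measurableSet_collision (φ x) (φ y))]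
    rfl
  simp_rw [hxy]
  rw [Finset.sum_congr rfl fun x _ => (integral_finsetSum _ fun y _ => hint x y).symm,
    ← integral_finsetSum _ fun x _ => integrable_finsetSum _ fun y _ => hint x y]
  exact integral_nonneg fun ω => sum_collision_nonneg (fun x => H.hash ω (φ x)) g

/-- If points at distance at most `R` are separated with probability at most `q`, then points
at distance at most `N * R` are separated with probability at most `N * q`: cut the segment between
them into `N` pieces. -/
lemma one_sub_collisionProb_le_mul {E : Type*} [NormedAddCommGroup E] [NormedSpace ℝ E]
    (φ : E → X) {R q : ℝ} (h : ∀ u v, ‖u - v‖ ≤ R → 1 - H.collisionProb (φ u) (φ v) ≤ q) :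
    ∀ (N : ℕ) (u v : E), ‖u - v‖ ≤ N * R → 1 - H.collisionProb (φ u) (φ v) ≤ N * q := by
  intro N
  induction N with
  | zero =>
    intro u v huv
    have : u = v := by simpa [sub_eq_zero] using huv
    simp [this, collisionProb_self]
  | succ N ih =>
    intro u v huv
    push_cast at huv ⊢
    have hN : (0 : ℝ) < N + 1 := by positivity
    let t : ℝ := 1 / (N + 1)
    have h1 : ‖u - AffineMap.lineMap u v t‖ ≤ R := by
      rw [← dist_eq_norm, dist_left_lineMap, Real.norm_of_nonneg (by positivity), dist_eq_norm]
      simp only [t]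
      rw [one_div, inv_mul_le_iff₀ hN]
      exact huv
    have h2 : ‖AffineMap.lineMap u v t - v‖ ≤ N * R := by
      have ht : 1 - t = N / (N + 1) := by simp only [t]; field_simp; ring
      rw [← dist_eq_norm, dist_lineMap_right, ht, Real.norm_of_nonneg (by positivity),
        dist_eq_norm, div_mul_eq_mul_div, div_le_iff₀ hN]
      calc N * ‖u - v‖ ≤ N * ((N + 1) * R) := by gcongr
        _ = _ := by ring
    linarith [H.one_sub_collisionProb_triangle (φ u) (φ (AffineMap.lineMap u v t)) (φ v),
      h _ _ h1, ih _ _ h2]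

end HashFamily

/-! ### The cube in a horosphere -/

namespace HyperbolicSpace

/-- The point of the horosphere `z = 1` above a point of the Euclidean space. -/
def horosphere {d : ℕ} (x : EuclideanSpace ℝ (Fin (d - 1))) : HyperbolicSpace d :=
  ⟨1, one_pos, x⟩

lemma dist_horosphere {d : ℕ} (x y : EuclideanSpace ℝ (Fin (d - 1))) :
    dist (horosphere x) (horosphere y) = Real.arcosh (1 + ‖x - y‖ ^ 2 / 2) := by
  simp [dist, horosphere]

lemma dist_horosphere_le {d : ℕ} {x y : EuclideanSpace ℝ (Fin (d - 1))} {r : ℝ} (hr : 0 ≤ r)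
    (h : ‖x - y‖ ^ 2 ≤ 2 * (Real.cosh r - 1)) : dist (horosphere x) (horosphere y) ≤ r := by
  rw [dist_horosphere, ← Real.arcosh_cosh hr,
    Real.arcosh_le_arcosh (by positivity) (Real.cosh_pos r)]
  linarith

lemma le_dist_horosphere {d : ℕ} {x y : EuclideanSpace ℝ (Fin (d - 1))} {r : ℝ} (hr : 0 ≤ r)
    (h : 2 * (Real.cosh r - 1) ≤ ‖x - y‖ ^ 2) : r ≤ dist (horosphere x) (horosphere y) := by
  rw [dist_horosphere]
  conv_lhs => rw [← Real.arcosh_cosh hr]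
  rw [Real.arcosh_le_arcosh (Real.cosh_pos r) (by positivity)]
  linarith

end HyperbolicSpace

/-- The embedding of the cube into Euclidean space with side length `s`. -/
noncomputable def cubePoint {n : ℕ} (s : ℝ) (x : Fin n → Bool) : EuclideanSpace ℝ (Fin n) :=
  WithLp.toLp 2 fun i => s / 2 * boolSign (x i)

lemma norm_cubePoint_sub_sq {n : ℕ} (s : ℝ) (x y : Fin n → Bool) :
    ‖cubePoint s x - cubePoint s y‖ ^ 2 = s ^ 2 * signDist x y := by
  rw [EuclideanSpace.norm_sq_eq, signDist, Finset.mul_sum]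
  refine Finset.sum_congr rfl fun i _ => ?_
  simp only [cubePoint, PiLp.sub_apply, Real.norm_eq_abs, sq_abs]
  linear_combination s ^ 2 / 4 * boolSign_mul_self (x i) + s ^ 2 / 4 * boolSign_mul_self (y i)

/-- The exponent bound in terms of the noise parameters. A hash family that is sensitive for the
cube at the distances `n a < n b`, where `a` lies above the mean distance
`(1 - ρ) / 2` of a coordinate of `ρ`-correlated points and `b` below that of
`ρ ^ α`-correlated ones, satisfies `K(ρ) ^ α ≤ K(ρ ^ α)` for its average collision probability `K`.
The errors in `K(ρ) ≥ p₁` and `K(ρ ^ α) ≤ p₂` are relative to `1 - p₁` and `1 - p₂`, which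
keeps the bound meaningful for probabilities close to `1`. -/
lemma collision_rpow_le {d : ℕ} (hd : 2 ≤ d) {r c p₁ p₂ : ℝ}
    {H : HashFamily.{u, v, 0} (HyperbolicSpace d)} (hH : H.IsSensitive r c p₁ p₂)
    {ρ α a b : ℝ} (hρ0 : 0 < ρ) (hρ1 : ρ < 1) (hα : 1 ≤ α)
    (ha : (1 - ρ) / 2 < a) (hb : b < (1 - ρ ^ α) / 2)
    (hab : a * (Real.cosh (c * r) - 1) ≤ b * (Real.cosh r - 1)) :
    ∃ K : ℝ, 1 - (1 - p₁) * (1 + 1 / a * (1 / ((a - (1 - ρ) / 2) ^ 2 * (d - 1 : ℕ)))) ≤ K ∧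
      K ^ α ≤ 1 - (1 - p₂) * (1 - 1 / (((1 - ρ ^ α) / 2 - b) ^ 2 * (d - 1 : ℕ))) := by
  obtain ⟨hr, hc, hp2, hp21, hp1, hnear, hfar⟩ := hH
  have hn : (0 : ℝ) < (d - 1 : ℕ) := by exact_mod_cast (by omega : 0 < d - 1)
  have ha0 : 0 < a := by linarith
  have hA : 0 < 2 * (Real.cosh r - 1) := by
    have := Real.one_lt_cosh.mpr hr.ne'
    linarith
  set A := 2 * (Real.cosh r - 1) with hA_def
  set n : ℝ := ((d - 1 : ℕ) : ℝ) with hn_def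
  let s : ℝ := √(A / (n * a))
  have hs : s ^ 2 = A / (n * a) := Real.sq_sqrt (by positivity)
  let φ : EuclideanSpace ℝ (Fin (d - 1)) → HyperbolicSpace d := HyperbolicSpace.horosphere
  let P : (Fin (d - 1) → Bool) → (Fin (d - 1) → Bool) → ℝ := fun x y =>
    H.collisionProb (φ (cubePoint s x)) (φ (cubePoint s y))
  have hstep (u v : EuclideanSpace ℝ (Fin (d - 1))) (huv : ‖u - v‖ ≤ √A) :
      1 - H.collisionProb (φ u) (φ v) ≤ 1 - p₁ := by
    have : ‖u - v‖ ^ 2 ≤ A := (Real.le_sqrt (norm_nonneg _) hA.le).mp huv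
    linarith [hnear _ _ (HyperbolicSpace.dist_horosphere_le hr.le this)]
  have hnorm (x y : Fin (d - 1) → Bool) :
      ‖cubePoint s x - cubePoint s y‖ = √(signDist x y / (n * a)) * √A := by
    have h1 := signDist_nonneg x y
    rw [← Real.sqrt_mul (by positivity), ← Real.sqrt_sq (norm_nonneg (_ - _)),
      norm_cubePoint_sub_sq, hs]
    congr 1
    ring
  refine ⟨noiseAverage ρ P, ?_, ?_⟩
  · have h := noiseAverage_le_of_concentrated (F := fun x y => 1 - P x y) (A := 1 - p₁)
      (B := (1 - p₁) * (1 / a)) (t := a - (1 - ρ) / 2) hρ0.le hρ1.le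
      (mul_nonneg (by linarith) (by positivity)) (by linarith) (by simp; omega) ?_ ?_
    · have h2 := noiseAverage_affine ρ 1 (-1) P
      simp only [neg_one_mul, ← sub_eq_add_neg] at h2
      rw [h2, Fintype.card_fin, ← hn_def] at h
      linarith
    · intro x y hxy
      rw [Fintype.card_fin, ← hn_def] at hxy
      have h1 : signDist x y ≤ n * a := by linarith [(abs_lt.mp hxy).2]
      refine hstep _ _ ?_
      rw [hnorm]
      refine mul_le_of_le_one_left (Real.sqrt_nonneg _) (Real.sqrt_le_one.mpr ?_)
      exact (div_le_one (by positivity)).mpr h1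
    · intro x y
      set k := signDist x y / (n * a) with hk
      have hk0 : 0 ≤ k := div_nonneg (signDist_nonneg x y) (by positivity)
      have hka : k ≤ 1 / a := by
        rw [hk, div_le_div_iff₀ (by positivity) ha0]
        have := signDist_le_card x y
        rw [Fintype.card_fin, ← hn_def] at this
        nlinarith
      have hN := H.one_sub_collisionProb_le_mul φ hstep ⌈√k⌉₊ (cubePoint s x) (cubePoint s y)
        (by rw [hnorm]; exact mul_le_mul_of_nonneg_right (Nat.le_ceil _) (Real.sqrt_nonneg _))
      have hceil : (⌈√k⌉₊ : ℝ) ≤ 1 + 1 / a := by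
        rcases le_or_gt k 1 with h1 | h1
        · have : ⌈√k⌉₊ ≤ 1 := Nat.ceil_le.mpr (by simpa using h1)
          have : (⌈√k⌉₊ : ℝ) ≤ 1 := by exact_mod_cast this
          have : 0 < 1 / a := by positivity
          linarith
        · have h2 := (Nat.ceil_lt_add_one (Real.sqrt_nonneg k)).le
          have h3 : √k ≤ k := Real.sqrt_le_iff.mpr ⟨hk0, by nlinarith⟩
          linarith
      calc 1 - P x y ≤ ⌈√k⌉₊ * (1 - p₁) := hN
        _ ≤ (1 + 1 / a) * (1 - p₁) := mul_le_mul_of_nonneg_right hceil (by linarith)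
        _ = _ := by ring
  · have hρα0 : 0 ≤ ρ ^ α := by positivity
    have hρα1 : ρ ^ α ≤ 1 := Real.rpow_le_one hρ0.le hρ1.le (by linarith)
    refine (noiseAverage_rpow_le (P := P) (fun g => H.sum_collisionProb_nonneg _ g)
      (fun x => H.collisionProb_self _) hρ0.le hα).trans ?_
    have h := noiseAverage_le_of_concentrated (F := P) (A := p₂)
      (B := 1 - p₂) (t := (1 - ρ ^ α) / 2 - b) hρα0 hρα1
      (by linarith) (by linarith) (by simp; omega) ?_ ?_
    · rw [Fintype.card_fin, ← hn_def] at h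
      linarith
    · intro x y hxy
      rw [Fintype.card_fin, ← hn_def] at hxy
      have h1 : n * b ≤ signDist x y := by linarith [(abs_lt.mp hxy).1]
      refine hfar _ _ (HyperbolicSpace.le_dist_horosphere (by positivity) ?_)
      rw [norm_cubePoint_sub_sq, hs, div_mul_eq_mul_div, le_div_iff₀ (by positivity)]
      calc 2 * (Real.cosh (c * r) - 1) * (n * a) = 2 * n * (a * (Real.cosh (c * r) - 1)) := by ring
        _ ≤ 2 * n * (b * (Real.cosh r - 1)) := by gcongr
        _ = A * (n * b) := by rw [hA_def]; ring
        _ ≤ _ := by gcongr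
    · intro x y
      have : P x y ≤ 1 := H.collisionProb_le_one _ _
      linarith

/-! ### The asymptotics -/

/-- Relative errors `η` in `1 - p₁` and `1 - p₂` change the logarithms of the probabilities by
the factors `1 + 2 η / δ` and `1 - η / δ`. -/
lemma lshExponent_ge_of_rpow_le {δ η p₁ p₂ K α : ℝ} (hδ : 0 < δ) (hη : 0 ≤ η) (hηδ : η / δ ≤ 1 / 2)
    (hp₂ : δ ≤ p₂) (hp : p₂ < p₁) (hp₁ : p₁ < 1) (hα : 1 ≤ α)
    (hK : 1 - (1 - p₁) * (1 + η) ≤ K) (hKα : K ^ α ≤ 1 - (1 - p₂) * (1 - η)) :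
    1 / α * ((1 - η / δ) / (1 + 2 * (η / δ))) ≤ lshExponent p₁ p₂ := by
  have hp₂0 : 0 < p₂ := hδ.trans_le hp₂
  have hp₁0 : 0 < p₁ := hp₂0.trans hp
  have hL₂ : 0 < -Real.log p₂ := by linarith [Real.log_neg hp₂0 (hp.trans hp₁)]
  have hθ0 : 0 ≤ η / δ := by positivity
  set θ := η / δ with hθ
  have hηp (p : ℝ) (hp : δ ≤ p) : η / p ≤ θ := by rw [hθ]; gcongr
  have hθ₁ := hηp p₁ (hp₂.trans hp.le)
  have hθ₂ := hηp p₂ hp₂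
  -- `x = η (1 - p₁) / p₁` is the relative error in `K ≥ p₁`
  set x := η / p₁ * (1 - p₁) with hx
  have hx0 : 0 ≤ x := mul_nonneg (by positivity) (by linarith)
  have hxθ : x ≤ θ * (1 - p₁) := mul_le_mul_of_nonneg_right hθ₁ (by linarith)
  have hx2 : x ≤ 1 / 2 := by nlinarith
  have hK' : p₁ * (1 - x) ≤ K := by
    refine le_trans (le_of_eq ?_) hK
    rw [hx]; field_simp; ring
  have hK0 : 0 < K := lt_of_lt_of_le (mul_pos hp₁0 (by linarith)) hK'
  have hlogK : Real.log p₁ - 2 * x ≤ Real.log K := by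
    refine le_trans ?_ (Real.log_le_log (mul_pos hp₁0 (by linarith)) hK')
    rw [Real.log_mul hp₁0.ne' (by linarith)]
    have h1 := Real.one_sub_inv_le_log_of_pos (by linarith : 0 < 1 - x)
    have h2 : (1 - x)⁻¹ ≤ 1 + 2 * x := by
      rw [inv_le_iff_one_le_mul₀ (by linarith)]
      nlinarith
    linarith
  have hlogKα : α * Real.log K ≤ Real.log p₂ + θ * (1 - p₂) := by
    rw [← Real.log_rpow hK0]
    refine (Real.log_le_log (Real.rpow_pos_of_pos hK0 α) hKα).trans ?_
    have h1 : 1 - (1 - p₂) * (1 - η) = p₂ * (1 + η / p₂ * (1 - p₂)) := by field_simp; ring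
    have h2 : 0 ≤ η / p₂ * (1 - p₂) := mul_nonneg (by positivity) (by linarith)
    rw [h1, Real.log_mul hp₂0.ne' (by linarith)]
    have h3 := Real.log_le_sub_one_of_pos (by linarith : 0 < 1 + η / p₂ * (1 - p₂))
    have h4 : η / p₂ * (1 - p₂) ≤ θ * (1 - p₂) := mul_le_mul_of_nonneg_right hθ₂ (by linarith)
    linarith
  have h1 := Real.log_le_sub_one_of_pos hp₁0
  have h2 := Real.log_le_sub_one_of_pos hp₂0
  have h3 : -Real.log K ≤ (1 + 2 * θ) * -Real.log p₁ := by nlinarith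
  have h4 : (1 - θ) * -Real.log p₂ ≤ α * -Real.log K := by nlinarith
  rw [lshExponent, one_div p₁, one_div p₂, Real.log_inv, Real.log_inv, le_div_iff₀ hL₂,
    div_mul_div_comm, one_mul, div_mul_eq_mul_div, div_le_iff₀ (by positivity)]
  calc (1 - θ) * -Real.log p₂ ≤ α * -Real.log K := h4
    _ ≤ α * ((1 + 2 * θ) * -Real.log p₁) := by gcongr
    _ = _ := by ring

lemma lshExponent_nonneg {p₁ p₂ : ℝ} (h₂ : 0 < p₂) (h : p₂ < p₁) (h₁ : p₁ < 1) :
    0 ≤ lshExponent p₁ p₂ := by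
  have h0 : 0 < p₁ := h₂.trans h
  exact div_nonneg (Real.log_nonneg ((one_le_div h0).mpr h₁.le))
    (Real.log_nonneg ((one_le_div h₂).mpr (h.trans h₁).le))

/-- The derivative of `ρ ^ α` at `1` is `α`. -/
lemma exists_noise_rate {α β : ℝ} (h : β < α) :
    ∃ ρ : ℝ, 0 < ρ ∧ ρ < 1 ∧ β * (1 - ρ) < 1 - ρ ^ α := by
  have hd : HasDerivAt (fun x : ℝ => x ^ α) α 1 := by
    simpa using Real.hasDerivAt_rpow_const (x := 1) (p := α) (Or.inl one_ne_zero)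
  have hs := (hasDerivAt_iff_tendsto_slope.mp hd).mono_left
    (nhdsWithin_mono (1 : ℝ) (fun x (hx : x < 1) => hx.ne))
  have h1 : ∀ᶠ x in 𝓝[<] (1 : ℝ), β < slope (fun x : ℝ => x ^ α) 1 x := hs.eventually_const_lt h
  have h2 : ∀ᶠ x in 𝓝[<] (1 : ℝ), x ∈ Set.Ioo 0 1 := Ioo_mem_nhdsLT one_pos
  obtain ⟨ρ, hρ, h0, hlt⟩ := (h1.and h2).exists
  refine ⟨ρ, h0, hlt, ?_⟩
  rw [slope_def_field, Real.one_rpow, ← neg_div_neg_eq, neg_sub, neg_sub,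
    lt_div_iff₀ (by linarith)] at hρ
  exact hρ

/-- At small scales hyperbolic distances on a horosphere are Euclidean to first order. -/
lemma eventually_cosh_mul_le {c β : ℝ} (h : c ^ 2 < β) :
    ∀ᶠ r in 𝓝 (0 : ℝ), Real.cosh (c * r) - 1 ≤ β * (Real.cosh r - 1) := by
  have hlim : Tendsto (fun r : ℝ => c ^ 2 * Real.exp ((c * r) ^ 2 / 2)) (𝓝 0) (𝓝 (c ^ 2)) := by
    have : Continuous fun r : ℝ => c ^ 2 * Real.exp ((c * r) ^ 2 / 2) := by fun_prop
    simpa using this.tendsto 0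
  filter_upwards [hlim.eventually_lt_const h] with r hr
  have h1 : Real.cosh (c * r) - 1 ≤ (c * r) ^ 2 / 2 * Real.exp ((c * r) ^ 2 / 2) := by
    have h2 := Real.cosh_le_exp_half_sq (c * r)
    have h3 := Real.add_one_le_exp (-((c * r) ^ 2 / 2))
    rw [Real.exp_neg] at h3
    have h4 := Real.exp_pos ((c * r) ^ 2 / 2)
    have h5 := mul_le_mul_of_nonneg_right h3 h4.le
    rw [inv_mul_cancel₀ h4.ne'] at h5
    linarith
  have h2 : r ^ 2 / 2 ≤ Real.cosh r - 1 := by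
    have h3 : Real.cosh r = 1 + 2 * Real.sinh (r / 2) ^ 2 := by
      have h4 := Real.cosh_two_mul (r / 2)
      have h5 := Real.cosh_sq (r / 2)
      rw [mul_div_cancel₀ r two_ne_zero] at h4
      linarith
    have h6 : (r / 2) ^ 2 ≤ Real.sinh (r / 2) ^ 2 := by
      rw [sq_le_sq]
      rcases le_total 0 (r / 2) with h0 | h0
      · have := Real.self_le_sinh_iff.mpr h0
        rwa [abs_of_nonneg h0, abs_of_nonneg (h0.trans this)]
      · have := Real.sinh_le_self_iff.mpr h0
        rw [abs_of_nonpos h0, abs_of_nonpos (this.trans h0)]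
        linarith
    linarith
  calc Real.cosh (c * r) - 1 ≤ (c * r) ^ 2 / 2 * Real.exp ((c * r) ^ 2 / 2) := h1
    _ = c ^ 2 * Real.exp ((c * r) ^ 2 / 2) * (r ^ 2 / 2) := by ring
    _ ≤ β * (r ^ 2 / 2) := by gcongr
    _ ≤ β * (Real.cosh r - 1) := mul_le_mul_of_nonneg_left h2 ((sq_nonneg c).trans h.le)

/-- A condition on `(d, κ)`, monotone in `κ`, that holds for every `κ > 0` once `d` is large holds
along a null sequence. -/
lemma exists_tendsto_zero_forall {Q : ℕ → ℝ → Prop} (hmono : ∀ d κ κ', κ ≤ κ' → Q d κ → Q d κ')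
    (hne : ∀ d, ∃ κ, 0 ≤ κ ∧ Q d κ) (hev : ∀ κ > 0, ∀ᶠ d in atTop, Q d κ) :
    ∃ ε : ℕ → ℝ, Tendsto ε atTop (𝓝 0) ∧ ∀ d, Q d (ε d) := by
  let S : ℕ → Set ℝ := fun d => {κ | 0 ≤ κ ∧ Q d κ}
  have hbdd (d : ℕ) : BddBelow (S d) := ⟨0, fun κ hκ => hκ.1⟩
  have hlim : Tendsto (fun d => sInf (S d)) atTop (𝓝 0) := by
    rw [tendsto_order]
    refine ⟨fun x hx => .of_forall fun d => hx.trans_le (Real.sInf_nonneg fun κ hκ => hκ.1),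
      fun x hx => ?_⟩
    filter_upwards [hev (x / 2) (by positivity)] with d hd
    have : sInf (S d) ≤ x / 2 := csInf_le (hbdd d) ⟨by positivity, hd⟩
    linarith
  refine ⟨fun d => sInf (S d) + 1 / ((d : ℝ) + 1), ?_, fun d => ?_⟩
  · simpa using hlim.add tendsto_one_div_add_atTop_nhds_zero_nat
  · obtain ⟨κ, hκ, hlt⟩ := exists_lt_of_csInf_lt (hne d)
      (lt_add_of_pos_right (sInf (S d)) (by positivity : 0 < 1 / ((d : ℝ) + 1)))
    exact hmono d κ _ hlt.le hκ.2

theorem theorem4 (c : ℝ) (hc : 1 < c) :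
    ∃ τ : ℕ → ℝ, (∀ d : ℕ, 0 < τ d ∧ τ d < 1) ∧
      ∀ δ : ℝ, 0 < δ → δ < 1 →
        ∃ ε : ℕ → ℝ, Tendsto ε atTop (𝓝 0) ∧
          ∀ d : ℕ, 1 ≤ d → ∀ p₁ p₂ : ℝ, δ ≤ p₂ → p₂ < p₁ → p₁ < 1 →
            ∀ H : HashFamily.{u, v, 0} (HyperbolicSpace d),
              H.IsSensitive (τ d * d) c p₁ p₂ →
                1 / c ^ 2 - ε d ≤ lshExponent p₁ p₂ := by
  have hc0 : 0 < c := by linarith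
  -- Any positive `τ d` with `τ d * d → 0` would do.
  refine ⟨fun d => 1 / ((d : ℝ) + 2) ^ 2, fun d => ⟨by positivity, ?_⟩, fun δ hδ hδ1 => ?_⟩
  · rw [div_lt_one (by positivity)]
    nlinarith [(Nat.cast_nonneg d : (0 : ℝ) ≤ d)]
  have hr0 : Tendsto (fun d : ℕ => 1 / ((d : ℝ) + 2) ^ 2 * d) atTop (𝓝 0) := by
    refine squeeze_zero (fun d => by positivity) (fun d => ?_)
      tendsto_one_div_add_atTop_nhds_zero_nat
    rw [div_mul_eq_mul_div, one_mul, div_le_div_iff₀ (by positivity) (by positivity)]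
    nlinarith [(Nat.cast_nonneg d : (0 : ℝ) ≤ d)]
  refine (exists_tendsto_zero_forall (Q := fun d κ => 1 ≤ d → ∀ p₁ p₂ : ℝ, δ ≤ p₂ → p₂ < p₁ →
    p₁ < 1 → ∀ H : HashFamily.{u, v, 0} (HyperbolicSpace d),
      H.IsSensitive (1 / ((d : ℝ) + 2) ^ 2 * d) c p₁ p₂ →
        1 / c ^ 2 - κ ≤ lshExponent p₁ p₂) ?_ ?_ ?_)
  · intro d κ κ' hκ h hd p₁ p₂ h₂ h₁₂ h₁ H hH
    linarith [h hd p₁ p₂ h₂ h₁₂ h₁ H hH]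
  · refine fun d => ⟨1 / c ^ 2, by positivity, fun _ p₁ p₂ h₂ h₁₂ h₁ _ _ => ?_⟩
    linarith [lshExponent_nonneg (hδ.trans_le h₂) h₁₂ h₁]
  intro κ hκ
  obtain ⟨α, hα, hακ⟩ : ∃ α : ℝ, c ^ 2 < α ∧ 1 / c ^ 2 - κ < 1 / α := by
    have h1 : ContinuousAt (fun α : ℝ => 1 / α) (c ^ 2) := by
      refine continuousAt_const.div continuousAt_id (by simp; positivity)
    have h2 : ∀ᶠ α in 𝓝[>] (c ^ 2), 1 / c ^ 2 - κ < 1 / α :=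
      (h1.eventually_const_lt (by linarith)).filter_mono nhdsWithin_le_nhds
    obtain ⟨α, h3, h4⟩ := (h2.and self_mem_nhdsWithin).exists
    exact ⟨α, h4, h3⟩
  have hα1 : 1 ≤ α := by nlinarith
  obtain ⟨ρ, hρ0, hρ1, hρ⟩ := exists_noise_rate hα
  -- thresholds with `(1 - ρ) / 2 < a`, `c² a < b` and `b < (1 - ρ ^ α) / 2`
  obtain ⟨b, hb1, hb2⟩ := exists_between (by linarith : c ^ 2 * ((1 - ρ) / 2) < (1 - ρ ^ α) / 2)
  obtain ⟨a, ha1, ha2⟩ := exists_between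
    (by rwa [lt_div_iff₀' (by positivity)] : (1 - ρ) / 2 < b / c ^ 2)
  have ha0 : 0 < a := by linarith
  rw [lt_div_iff₀' (by positivity)] at ha2
  have hcosh := hr0.eventually (eventually_cosh_mul_le ((lt_div_iff₀ ha0).mpr ha2))
  let E : ℝ := 1 / a * (1 / (a - (1 - ρ) / 2) ^ 2) + 1 / ((1 - ρ ^ α) / 2 - b) ^ 2
  have hη : Tendsto (fun d : ℕ => E / (d - 1 : ℕ) / δ) atTop (𝓝 0) := by
    have := ((tendsto_const_div_atTop_nhds_zero_nat E).comp (tendsto_sub_atTop_nat 1)).div_const δ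
    simpa using this
  have hbound : Tendsto (fun d : ℕ => 1 / α * ((1 - E / (d - 1 : ℕ) / δ) /
      (1 + 2 * (E / (d - 1 : ℕ) / δ)))) atTop (𝓝 (1 / α)) := by
    have := ((hη.const_sub 1).div ((hη.const_mul 2).const_add 1) (by norm_num)).const_mul (1 / α)
    simpa using this
  filter_upwards [hcosh, hη.eventually_le_const (by norm_num : (0 : ℝ) < 1 / 2),
    hbound.eventually_const_lt hακ, eventually_ge_atTop 2] with d h1 h2 h3 h4
  intro _ p₁ p₂ hp₂ hp hp₁ H hH
  have hn : (0 : ℝ) < (d - 1 : ℕ) := by exact_mod_cast (by omega : 0 < d - 1)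
  have hab : a * (Real.cosh (c * (1 / ((d : ℝ) + 2) ^ 2 * d)) - 1) ≤
      b * (Real.cosh (1 / ((d : ℝ) + 2) ^ 2 * d) - 1) := by
    calc _ ≤ a * (b / a * (Real.cosh (1 / ((d : ℝ) + 2) ^ 2 * d) - 1)) := by gcongr
      _ = _ := by field_simp
  obtain ⟨K, hK1, hK2⟩ := collision_rpow_le h4 hH hρ0 hρ1 hα1 ha1 hb2 hab
  have hEa : 1 / a * (1 / ((a - (1 - ρ) / 2) ^ 2 * (d - 1 : ℕ))) ≤ E / (d - 1 : ℕ) := by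
    simp only [E]
    rw [← div_div, mul_div_assoc']
    gcongr
    have : 0 ≤ 1 / ((1 - ρ ^ α) / 2 - b) ^ 2 := by positivity
    linarith
  have hEb : 1 / (((1 - ρ ^ α) / 2 - b) ^ 2 * (d - 1 : ℕ)) ≤ E / (d - 1 : ℕ) := by
    simp only [E]
    rw [← div_div]
    gcongr
    have : 0 ≤ 1 / a * (1 / (a - (1 - ρ) / 2) ^ 2) := by positivity
    linarith
  refine h3.le.trans (lshExponent_ge_of_rpow_le (η := E / (d - 1 : ℕ)) (K := K) hδ
    (by simp only [E]; positivity) h2 hp₂ hp hp₁ hα1 ?_ ?_)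
  · refine le_trans ?_ hK1
    have : 0 ≤ 1 - p₁ := by linarith
    gcongr
  · refine hK2.trans ?_
    have : 0 ≤ 1 - p₂ := by linarith
    gcongr
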